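/- Fix a set $A$ of atoms. **Formulas.** Formulas are built from atoms and a constant $\lambda$ by weak negation $-X$ and the conditional $X\supset Y$. Abbreviations: ${\sim}X=X\supset-\lambda$, $+X={\sim}{-X}$, $X\cup Y={\sim}X\supset Y$, $X\wedge Y={\sim}(X\supset{\sim}Y)$. **GT and GT4.** The schemes of GT are (1) $\lambda$; (2) $X\supset(Y\supset X)$; (3) $(X\supset(Y\supset Z))\supset((X\supset Y)\supset(X\supset Z))$; (4) $((X\supset Y)\supset X)\supset X$; (5) $-\lambda\supset Z$; (6) $(X\supset-\lambda)\supset-X$; (7) $+(X\supset Y)\supset(+X\supset+Y)$. GT4 has in addition the scheme $+X\supset[-(+X\wedge Y)\supset-Y]$. In each system the axioms are the instances $X$ of its schemes together with $+X$ for each such instance, and modus ponens is the only rule. A theorem is a formula provable from the axioms; $Y$ is a consequence of $X$ if $Y$ is provable from the axioms and the assumption $X$. **Models.** A model consists of a set $S$ of worlds, a reflexive relation $<$ on $S$, an actual world in $S$ and a valuation. Here $\lambda$ is true at every world, $\supset$ is classical at each world, and $-X$ is true at $M$ iff $X$ is false at some $P$ with $M<P$. A formula is true in a model if it is true at its actual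 world. **Graphs.** Graphs are built from atoms and the empty graph $\lambda$ by juxtaposition $XY$, the continuous cut $(X)$ and the broken cut $\{X\}$; put $*X=(\{X\})$. A region is even or odd according to the number of cuts (of both kinds) around it. The rules of GET are, in any region unless restricted: - R1: $\lambda\Rightarrow(\{\lambda\})$. - R2: $XY\Rightarrow X$ in even regions; $X\Rightarrow XY$ in odd regions. - R3: $Y\,C[X]\Leftrightarrow Y\,C[XY]$ if $X$ lies in $C$ inside continuous cuts only (possibly none); $X\Leftrightarrow XX$; $*Y\,C[X]\Leftrightarrow *Y\,C[XY]$ if $X$ lies in $C$ inside exactly one broken cut (and any number of continuous cuts). - R4: $(X)\Rightarrow\{X\}$ in even regions; $\{X\}\Rightarrow(X)$ in odd regions. - R6: $((X))\Rightarrow X$ in even regions; $X\Rightarrow((X))$ in odd regions. - Juxtaposition is commutative and associative, and $X\Leftrightarrow X\lambda$. GET4 is GET plus strong iteration/deiteration: $*Y\,C[X]\Leftrightarrow *Y\,C[*Y\,X]$ if $X$ lies in $C$ inside at least one broken cut. In GET4, $G\gg H$ means that $H$ is obtained from $G$ by finitely many applications of the rules, and $G$ is a graphical theorem if $\lambda\gg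 G$. **Translations.** $P'=P$, $\lambda'=\lambda$, $(-X)'=\{X'\}$, $(X\supset Y)'=(X'(Y'))$, $(X\cup Y)'=((X')(Y'))$, $(X\wedge Y)'=X'Y'$, $({\sim}X)'=(X')$. In the other direction, $P''=P$, $\lambda''=\lambda$, $\{X\}''=-X''$, $(X(Y))''=X''\supset Y''$, $((X)(Y))''=X''\cup Y''$, $(X)''={\sim}X''$, $(XY)''=X''\wedge Y''$. As ${\sim},\cup,\wedge$ are abbreviations and $(X(Y))$ is itself a cut, several clauses may apply to the same object; the statements below hold for every way of applying the clauses. **Theorem.** 1. If $A\neq\emptyset$ then, for every set $S$ and every reflexive relation $<$ on $S$: all formulas $+X\supset[-(+X\wedge Y)\supset-Y]$ are true in all models with worlds $S$ and accessibility $<$ if and only if $<$ is transitive. 2. For all graphs $G,H$ and all formulas $X,Y$: - a) $G$ is a graphical theorem of GET4 iff $G''$ is a theorem of GT4; - b) $X$ is a theorem of GT4 iff $X'$ is a graphical theorem of GET4; - c) $G\gg H$ in GET4 iff $H''$ is a consequence of $G''$ in GT4; - d) $X'\gg Y'$ in GET4 iff $Y$ is a consequence of $X$ in GT4. -/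

import Mathlib

universe u v

namespace ExGraph

/-! ### Formulas -/

/-- Formulas: atoms, the constant `λ` (`lam`), the weak negation `-X` (`neg`) and the conditional. -/
inductive Formula (Atom : Type u) : Type u
  | atom : Atom → Formula Atom
  | lam : Formula Atom
  | neg : Formula Atom → Formula Atom
  | imp : Formula Atom → Formula Atom → Formula Atom

namespace Formula

variable {Atom : Type u}

/-- Classical negation `~X = X ⊃ -λ`. -/
def cneg (X : Formula Atom) : Formula Atom := X.imp lam.neg

/-- Strong affirmation `+X = ~-X`. -/
def strong (X : Formula Atom) : Formula Atom := X.neg.cneg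

/-- Disjunction `X ∪ Y = ~X ⊃ Y`. -/
def or (X Y : Formula Atom) : Formula Atom := X.cneg.imp Y

/-- Conjunction `X ∩ Y = ~(X ⊃ ~Y)`. -/
def and (X Y : Formula Atom) : Formula Atom := (X.imp Y.cneg).cneg

/-- The formula `+X ⊃ [-(+X ∧ Y) ⊃ -Y]`. -/
def four (X Y : Formula Atom) : Formula Atom :=
  X.strong.imp (((X.strong.and Y).neg).imp Y.neg)

end Formula

/-! ### The deductive systems GT and GT4 -/

/-- The axiom schemes Ax1 - Ax7 of GT. -/
inductive GTScheme {Atom : Type u} : Formula Atom → Prop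
  | ax1 : GTScheme Formula.lam
  | ax2 (X Y : Formula Atom) : GTScheme (X.imp (Y.imp X))
  | ax3 (X Y Z : Formula Atom) :
      GTScheme ((X.imp (Y.imp Z)).imp ((X.imp Y).imp (X.imp Z)))
  | ax4 (X Y : Formula Atom) : GTScheme (((X.imp Y).imp X).imp X)
  | ax5 (Z : Formula Atom) : GTScheme (Formula.lam.neg.imp Z)
  | ax6 (X : Formula Atom) : GTScheme ((X.imp Formula.lam.neg).imp X.neg)
  | ax7 (X Y : Formula Atom) :
      GTScheme (((X.imp Y).neg.imp Formula.lam.neg).imp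
        ((X.neg.imp Formula.lam.neg).imp (Y.neg.imp Formula.lam.neg)))

/-- The schemes of GT4: those of GT and `+X ⊃ [-(+X ∧ Y) ⊃ -Y]`. -/
inductive GT4Scheme {Atom : Type u} : Formula Atom → Prop
  | ofGT {X : Formula Atom} : GTScheme X → GT4Scheme X
  | four (X Y : Formula Atom) : GT4Scheme (Formula.four X Y)

/-- Ax+: the axioms are the instances `X` of the schemes, together with `-X ⊃ -λ` for each of
them. -/
inductive WithPlus {Atom : Type u} (B : Formula Atom → Prop) : Formula Atom → Prop
  | base {X : Formula Atom} : B X → WithPlus B X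
  | plus {X : Formula Atom} : B X → WithPlus B (X.neg.imp Formula.lam.neg)

/-- `Derives Ax Γ X`: there is a proof of `X` from the axioms `Ax` and the assumptions `Γ`, with
modus ponens as the only rule of inference. -/
inductive Derives {Atom : Type u} (Ax : Formula Atom → Prop) (Γ : Set (Formula Atom)) :
    Formula Atom → Prop
  | ax {X : Formula Atom} : Ax X → Derives Ax Γ X
  | hyp {X : Formula Atom} : X ∈ Γ → Derives Ax Γ X
  | mp {X Z : Formula Atom} : Derives Ax Γ X → Derives Ax Γ (X.imp Z) → Derives Ax Γ Z

/-- The axioms of GT. -/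
def GTAxiom {Atom : Type u} : Formula Atom → Prop := WithPlus GTScheme

/-- The axioms of GT4. -/
def GT4Axiom {Atom : Type u} : Formula Atom → Prop := WithPlus GT4Scheme

/-- `X` is a theorem of GT4. -/
def TT4 {Atom : Type u} (X : Formula Atom) : Prop := Derives GT4Axiom ∅ X

/-- `Y` is a consequence of `X` in GT4. -/
def Consequence4 {Atom : Type u} (X Y : Formula Atom) : Prop := Derives GT4Axiom {X} Y

/-! ### Possible worlds semantics of GT -/

/-- A frame of GT: a set `S` of worlds with a reflexive accessibility relation. -/
structure Frame (S : Type v) where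
  rel : S → S → Prop
  refl : ∀ M, rel M M

/-- The models of GT with worlds and accessibility given by the frame `F`: an actual world and a
valuation of the atoms, which `Model.holds` extends to all formulas. -/
structure Model (Atom : Type u) {S : Type v} (F : Frame S) where
  actual : S
  val : S → Atom → Prop

/-- Truth of a formula in a world of a model. -/
def Model.holds {Atom : Type u} {S : Type v} {F : Frame S} (Mo : Model Atom F) :
    S → Formula Atom → Prop
  | M, .atom p => Mo.val M p
  | _, .lam => True
  | M, .neg X => ∃ P, F.rel M P ∧ ¬ Mo.holds P X
  | M, .imp X Y => Mo.holds M X → Mo.holds M Y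

/-- A formula is true in a model if it is true in its actual world. -/
def Model.IsTrue {Atom : Type u} {S : Type v} {F : Frame S} (Mo : Model Atom F)
    (X : Formula Atom) : Prop := Mo.holds Mo.actual X

/-! ### Existential graphs -/

/-- Existential graphs: atoms, the empty graph `λ`, juxtaposition `XY`, the continuous cut `(X)`
and the broken cut `{X}`. -/
inductive Graph (Atom : Type u) : Type u
  | atom : Atom → Graph Atom
  | blank : Graph Atom
  | juxt : Graph Atom → Graph Atom → Graph Atom
  | cut : Graph Atom → Graph Atom
  | broken : Graph Atom → Graph Atom

namespace Graph

variable {Atom : Type u}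

/-- The conditional graph `(X(Y))`. -/
def cond (X Y : Graph Atom) : Graph Atom := cut (juxt X (cut Y))

/-- The strong graph `*X = ({X})`. -/
def star (X : Graph Atom) : Graph Atom := cut (broken X)

end Graph

/-- A graph with a marked region (a hole). -/
inductive Ctx (Atom : Type u) : Type u
  | hole : Ctx Atom
  | juxtL : Ctx Atom → Graph Atom → Ctx Atom
  | juxtR : Graph Atom → Ctx Atom → Ctx Atom
  | cut : Ctx Atom → Ctx Atom
  | broken : Ctx Atom → Ctx Atom

namespace Ctx

variable {Atom : Type u}

/-- Put a graph in the marked region. -/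
def fill : Ctx Atom → Graph Atom → Graph Atom
  | hole, X => X
  | juxtL C G, X => .juxt (C.fill X) G
  | juxtR G C, X => .juxt G (C.fill X)
  | cut C, X => .cut (C.fill X)
  | broken C, X => .broken (C.fill X)

/-- The number of continuous cuts around the marked region. -/
def cuts : Ctx Atom → ℕ
  | hole => 0
  | juxtL C _ => C.cuts
  | juxtR _ C => C.cuts
  | cut C => C.cuts + 1
  | broken C => C.cuts

/-- The number of broken cuts around the marked region. -/
def brokenCuts : Ctx Atom → ℕ
  | hole => 0
  | juxtL C _ => C.brokenCuts
  | juxtR _ C => C.brokenCuts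
  | cut C => C.brokenCuts
  | broken C => C.brokenCuts + 1

/-- The marked region is surrounded by an even number of cuts. -/
def IsEven (C : Ctx Atom) : Prop := Even (C.cuts + C.brokenCuts)

/-- The marked region is surrounded by an odd number of cuts. -/
def IsOdd (C : Ctx Atom) : Prop := Odd (C.cuts + C.brokenCuts)

end Ctx

open _root_.ExGraph.Graph in
/-- One application of a transformation rule of GET. `K` is the region where the rule is applied;
in the iteration rules, `C` leads from the region of the iterated graph to that of its copy. -/
inductive GETStep {Atom : Type u} : Graph Atom → Graph Atom → Prop
  /-- R1: writing the strong double cut -/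
  | strongDoubleCut (K : Ctx Atom) : GETStep (K.fill blank) (K.fill (star blank))
  /-- R2: erasure in even regions, writing in odd regions -/
  | erase (K : Ctx Atom) (X Y : Graph Atom) : K.IsEven →
      GETStep (K.fill (juxt X Y)) (K.fill X)
  | write (K : Ctx Atom) (X Y : Graph Atom) : K.IsOdd →
      GETStep (K.fill X) (K.fill (juxt X Y))
  /-- R3: iteration and deiteration through continuous cuts only -/
  | iter (K C : Ctx Atom) (X Y : Graph Atom) : C.brokenCuts = 0 →
      GETStep (K.fill (juxt Y (C.fill X))) (K.fill (juxt Y (C.fill (juxt X Y))))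
  | deiter (K C : Ctx Atom) (X Y : Graph Atom) : C.brokenCuts = 0 →
      GETStep (K.fill (juxt Y (C.fill (juxt X Y)))) (K.fill (juxt Y (C.fill X)))
  | dup (K : Ctx Atom) (X : Graph Atom) : GETStep (K.fill X) (K.fill (juxt X X))
  | undup (K : Ctx Atom) (X : Graph Atom) : GETStep (K.fill (juxt X X)) (K.fill X)
  /-- R3, through one broken cut: a strong graph `*Y` outside allows `Y` to be iterated and
  deiterated inside -/
  | iterBroken (K C : Ctx Atom) (X Y : Graph Atom) : C.brokenCuts = 1 →
      GETStep (K.fill (juxt (star Y) (C.fill X))) (K.fill (juxt (star Y) (C.fill (juxt X Y))))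
  | deiterBroken (K C : Ctx Atom) (X Y : Graph Atom) : C.brokenCuts = 1 →
      GETStep (K.fill (juxt (star Y) (C.fill (juxt X Y)))) (K.fill (juxt (star Y) (C.fill X)))
  /-- R4: partial erasure of a continuous cut, completion of a broken cut -/
  | breakCut (K : Ctx Atom) (X : Graph Atom) : K.IsEven →
      GETStep (K.fill (cut X)) (K.fill (broken X))
  | completeCut (K : Ctx Atom) (X : Graph Atom) : K.IsOdd →
      GETStep (K.fill (broken X)) (K.fill (cut X))
  /-- R6: erasure and writing of a continuous double cut -/
  | eraseDoubleCut (K : Ctx Atom) (X : Graph Atom) : K.IsEven →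
      GETStep (K.fill (cut (cut X))) (K.fill X)
  | writeDoubleCut (K : Ctx Atom) (X : Graph Atom) : K.IsOdd →
      GETStep (K.fill X) (K.fill (cut (cut X)))
  /-- R7 - R9: juxtaposition is commutative and associative, and the empty graph may be
  juxtaposed or dropped, in any region -/
  | comm (K : Ctx Atom) (X Y : Graph Atom) : GETStep (K.fill (juxt X Y)) (K.fill (juxt Y X))
  | assoc (K : Ctx Atom) (X Y Z : Graph Atom) :
      GETStep (K.fill (juxt (juxt X Y) Z)) (K.fill (juxt X (juxt Y Z)))
  | unassoc (K : Ctx Atom) (X Y Z : Graph Atom) :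
      GETStep (K.fill (juxt X (juxt Y Z))) (K.fill (juxt (juxt X Y) Z))
  | addBlank (K : Ctx Atom) (X : Graph Atom) : GETStep (K.fill X) (K.fill (juxt X blank))
  | dropBlank (K : Ctx Atom) (X : Graph Atom) : GETStep (K.fill (juxt X blank)) (K.fill X)

open _root_.ExGraph.Graph in
/-- One application of a transformation rule of GET4: a rule of GET, or strong iteration or
deiteration `*Y [X] ⇔ *Y [*Y X]` into a region inside at least one broken cut. -/
inductive GET4Step {Atom : Type u} : Graph Atom → Graph Atom → Prop
  | ofGET {G H : Graph Atom} : GETStep G H → GET4Step G H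
  | strongIter (K C : Ctx Atom) (X Y : Graph Atom) : 1 ≤ C.brokenCuts →
      GET4Step (K.fill (juxt (star Y) (C.fill X)))
        (K.fill (juxt (star Y) (C.fill (juxt (star Y) X))))
  | strongDeiter (K C : Ctx Atom) (X Y : Graph Atom) : 1 ≤ C.brokenCuts →
      GET4Step (K.fill (juxt (star Y) (C.fill (juxt (star Y) X))))
        (K.fill (juxt (star Y) (C.fill X)))

/-- `G ≫ H` in GET4: `H` is obtained from `G` by finitely many applications of the rules. -/
def Transforms4 {Atom : Type u} (G H : Graph Atom) : Prop := Relation.ReflTransGen GET4Step G H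

/-- `G` is a graphical theorem of GET4. -/
def TGET4 {Atom : Type u} (G : Graph Atom) : Prop := Transforms4 Graph.blank G

/-! ### The translations

A formula such as `~X` is also a conditional, and a graph `(X(Y))` is also a cut around a
juxtaposition, so several clauses can apply to the same object. The translations are therefore
relations: `ToGraph X G` says that `G` is an `X′`, `ToFormula G X` that `X` is a `G″`, obtained
by any use of the clauses. -/

open _root_.ExGraph.Graph in
/-- `ToGraph X G`: the graph `G` is a translation `X′` of the formula `X`. -/
inductive ToGraph {Atom : Type u} : Formula Atom → Graph Atom → Prop
  | atom (p : Atom) : ToGraph (.atom p) (atom p)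
  | lam : ToGraph .lam blank
  | neg {X G} : ToGraph X G → ToGraph X.neg (broken G)
  | imp {X Y G H} : ToGraph X G → ToGraph Y H → ToGraph (X.imp Y) (cond G H)
  | or {X Y G H} : ToGraph X G → ToGraph Y H → ToGraph (X.or Y) (cut (juxt (cut G) (cut H)))
  | and {X Y G H} : ToGraph X G → ToGraph Y H → ToGraph (X.and Y) (juxt G H)
  | cneg {X G} : ToGraph X G → ToGraph X.cneg (cut G)

open _root_.ExGraph.Graph in
/-- `ToFormula G X`: the formula `X` is a translation `G″` of the graph `G`. -/
inductive ToFormula {Atom : Type u} : Graph Atom → Formula Atom → Prop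
  | atom (p : Atom) : ToFormula (atom p) (.atom p)
  | blank : ToFormula blank .lam
  | cond {G H X Y} : ToFormula G X → ToFormula H Y → ToFormula (cond G H) (X.imp Y)
  | disj {G H X Y} : ToFormula G X → ToFormula H Y →
      ToFormula (cut (juxt (cut G) (cut H))) (X.or Y)
  | cut {G X} : ToFormula G X → ToFormula (cut G) X.cneg
  | broken {G X} : ToFormula G X → ToFormula (broken G) X.neg
  | juxt {G H X Y} : ToFormula G X → ToFormula H Y → ToFormula (juxt G H) (X.and Y)

theorem exists_toGraph {Atom : Type u} (X : Formula Atom) : ∃ G, ToGraph X G := by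
  induction X with
  | atom p => exact ⟨_, .atom p⟩
  | lam => exact ⟨_, .lam⟩
  | neg X ih => obtain ⟨G, h⟩ := ih; exact ⟨_, .neg h⟩
  | imp X Y ih ih2 => obtain ⟨G, h⟩ := ih; obtain ⟨H, k⟩ := ih2; exact ⟨_, .imp h k⟩

theorem exists_toFormula {Atom : Type u} (G : Graph Atom) : ∃ X, ToFormula G X := by
  induction G with
  | atom p => exact ⟨_, .atom p⟩
  | blank => exact ⟨_, .blank⟩
  | juxt G H ih ih2 => obtain ⟨X, h⟩ := ih; obtain ⟨Y, k⟩ := ih2; exact ⟨_, .juxt h k⟩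
  | cut G ih => obtain ⟨X, h⟩ := ih; exact ⟨_, .cut h⟩
  | broken G ih => obtain ⟨X, h⟩ := ih; exact ⟨_, .broken h⟩

end ExGraph

/-! The modal equivalences pass through models with reflexive and transitive accessibility in one
direction and through syntax in the other.

From graphs to formulas: every rule of GET4 preserves truth at each world of a transitive model
(`Transforms4.sound`), and every use of the translation clauses preserves truth values
(`ToGraph.holds_iff`, `ToFormula.holds_iff`). So a transformation yields semantic entailment, and a
canonical model of maximal theories turns entailment into a GT4 derivation
(`TransitiveEntails.consequence4`).

From formulas to graphs: each axiom has a graph obtainable from the empty graph (`GT4Axiom.graph`),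
and modus ponens is deiteration followed by erasure of a double cut (`Transforms4.mp`), so proofs
are simulated step by step. This is done for one fixed translation `Formula.graph`; any other is
interderivable with it. The calculus rests on the fact that transformations may be used inside even
regions and reversed inside odd ones (`Transforms4.fill_even`, `Transforms4.fill_odd`).

The theorem cases are the consequence cases with premise `λ`, which is an axiom. The frame
correspondence is a separate argument by a countermodel. -/

namespace ExGraph

/-! ### The added axiom and transitivity -/

section Semantics

variable {Atom : Type u} {S : Type v} {F : Frame S} (Mo : Model Atom F) (M : S)

@[simp] theorem Model.holds_lam : Mo.holds M .lam := trivial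

@[simp] theorem Model.holds_neg (X : Formula Atom) :
    Mo.holds M X.neg ↔ ∃ P, F.rel M P ∧ ¬ Mo.holds P X := Iff.rfl

@[simp] theorem Model.holds_imp (X Y : Formula Atom) :
    Mo.holds M (X.imp Y) ↔ (Mo.holds M X → Mo.holds M Y) := Iff.rfl

@[simp] theorem Model.holds_cneg (X : Formula Atom) :
    Mo.holds M X.cneg ↔ ¬ Mo.holds M X := by
  simp [Formula.cneg]

@[simp] theorem Model.holds_strong (X : Formula Atom) :
    Mo.holds M X.strong ↔ ∀ P, F.rel M P → Mo.holds P X := by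
  simp [Formula.strong]

@[simp] theorem Model.holds_or (X Y : Formula Atom) :
    Mo.holds M (X.or Y) ↔ Mo.holds M X ∨ Mo.holds M Y := by
  simp [Formula.or, or_iff_not_imp_left]

@[simp] theorem Model.holds_and (X Y : Formula Atom) :
    Mo.holds M (X.and Y) ↔ Mo.holds M X ∧ Mo.holds M Y := by
  simp [Formula.and]

theorem Model.holds_four (hF : ∀ M N P : S, F.rel M N → F.rel N P → F.rel M P)
    (X Y : Formula Atom) : Mo.holds M (Formula.four X Y) := by
  simp only [Formula.four, holds_imp, holds_strong, holds_neg, holds_and]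
  rintro hX ⟨P, hP, h⟩
  exact ⟨P, hP, fun hY => h ⟨fun Q hQ => hX Q (hF _ _ _ hP hQ), hY⟩⟩

theorem four_isTrue_iff_transitive [Nonempty Atom] (F : Frame S) :
    (∀ (Mo : Model Atom F) (X Y : Formula Atom), Mo.IsTrue (Formula.four X Y)) ↔
      ∀ M N P : S, F.rel M N → F.rel N P → F.rel M P := by
  refine ⟨fun h M N P hMN hNP => ?_, fun hF Mo X Y => Mo.holds_four _ hF X Y⟩
  by_contra hMP
  obtain ⟨p⟩ := ‹Nonempty Atom›
  -- Make `p` true exactly at the worlds accessible from `M`. Then `+p` holds at `M` but fails at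
  -- `N` because of `P`, so both antecedents hold at `M`, while the conclusion `-λ` holds nowhere.
  have := h ⟨M, fun Q _ => F.rel M Q⟩ (.atom p) .lam
  simp only [Model.IsTrue, Formula.four, Model.holds_imp, Model.holds_strong, Model.holds_neg,
    Model.holds_and, Model.holds_lam] at this
  obtain ⟨_, _, h⟩ := this (fun _ h => h) ⟨N, hMN, fun h => hMP (h.1 P hNP)⟩
  exact h trivial

end Semantics

/-! ### Completeness of GT4 for transitive frames -/

section Completeness

variable {Atom : Type u} {Γ Δ T : Set (Formula Atom)} {X Y Z : Formula Atom}

theorem Derives.mono {Ax : Formula Atom → Prop} (hΓ : Γ ⊆ Δ) (h : Derives Ax Γ X) :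
    Derives Ax Δ X := by
  induction h with
  | ax h => exact .ax h
  | hyp h => exact .hyp (hΓ h)
  | mp _ _ ih ih' => exact .mp ih ih'

theorem GTScheme.gt4Axiom (h : GTScheme X) : GT4Axiom X := .base (.ofGT h)

theorem Derives.weaken {Ax : Formula Atom → Prop} (hAx : ∀ {X}, GTScheme X → Ax X)
    (h : Derives Ax Γ X) : Derives Ax Γ (Y.imp X) :=
  .mp h (.ax (hAx (.ax2 _ _)))

theorem Derives.imp_mp {Ax : Formula Atom → Prop} (hAx : ∀ {X}, GTScheme X → Ax X)
    (h : Derives Ax Γ (X.imp Y)) (h' : Derives Ax Γ (X.imp (Y.imp Z))) :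
    Derives Ax Γ (X.imp Z) :=
  .mp h (.mp h' (.ax (hAx (.ax3 _ _ _))))

theorem Derives.imp_refl {Ax : Formula Atom → Prop} (hAx : ∀ {X}, GTScheme X → Ax X) :
    Derives Ax Γ (X.imp X) :=
  .imp_mp hAx (Y := X.imp X) (.ax (hAx (.ax2 _ _))) (.ax (hAx (.ax2 _ _)))

theorem Derives.deduction {Ax : Formula Atom → Prop} (hAx : ∀ {X}, GTScheme X → Ax X)
    (h : Derives Ax (insert X Γ) Y) : Derives Ax Γ (X.imp Y) := by
  induction h with
  | ax h => exact .weaken hAx (.ax h)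
  | hyp h =>
    rcases h with rfl | h
    · exact .imp_refl hAx
    · exact .weaken hAx (.hyp h)
  | mp _ _ ih ih' => exact .imp_mp hAx ih ih'

theorem Derives.peirce {Ax : Formula Atom → Prop} (hAx : ∀ {X}, GTScheme X → Ax X)
    (h : Derives Ax (insert (X.imp Y) Γ) X) : Derives Ax Γ X :=
  .mp (.deduction hAx h) (.ax (hAx (.ax4 X Y)))

theorem Derives.and_imp_left {Ax : Formula Atom → Prop} (hAx : ∀ {X}, GTScheme X → Ax X) :
    Derives Ax Γ ((X.and Y).imp X) :=
  .deduction hAx <| .peirce hAx (Y := Y.cneg) <|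
    .mp (.mp (.hyp (.inl rfl)) (.hyp (.inr (.inl rfl)))) (.ax (hAx (.ax5 X)))

theorem Derives.strong_mp (h : Derives GT4Axiom Γ X.strong)
    (h' : Derives GT4Axiom Γ (X.imp Y).strong) : Derives GT4Axiom Γ Y.strong :=
  .mp h (.mp h' (.ax (GTScheme.ax7 X Y).gt4Axiom))

/-- A restricted necessitation: only bare scheme instances are allowed, since their `+` versions are
axioms outright. Full necessitation must also treat the axioms `+X`, which needs
`Derives.strong_strong`. -/
theorem Derives.strong_of_scheme (h : Derives GT4Scheme ∅ X) :
    Derives GT4Axiom ∅ X.strong := by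
  induction h with
  | ax h => exact .ax (.plus h)
  | hyp h => exact h.elim
  | mp _ _ ih ih' => exact .strong_mp ih ih'

/-- With `Y = λ`, the added scheme reads `+X ⊃ +(+X ∧ λ)`; the conjunct `λ` is then removed under
`+`. -/
theorem Derives.strong_strong : Derives GT4Axiom ∅ (X.strong.imp X.strong.strong) :=
  .deduction GTScheme.gt4Axiom <| .strong_mp (X := X.strong.and .lam)
    (.mp (.hyp (.inl rfl)) (.ax (.base (.four X .lam))))
    ((strong_of_scheme (.and_imp_left .ofGT)).mono (Set.empty_subset _))

theorem Derives.necessitation (h : Derives GT4Axiom ∅ X) : Derives GT4Axiom ∅ X.strong := by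
  induction h with
  | ax h =>
    cases h with
    | base h => exact .ax (.plus h)
    | plus h => exact .mp (.ax (.plus h)) .strong_strong
  | hyp h => exact h.elim
  | mp _ _ ih ih' => exact .strong_mp ih ih'

/-- A derivation uses finitely many assumptions, and in a chain one member contains them all. This
is the upper bound needed for Zorn's lemma. -/
theorem Derives.exists_mem_chain {Ax : Formula Atom → Prop} {c : Set (Set (Formula Atom))}
    (hc : IsChain (· ⊆ ·) c) (hne : c.Nonempty) (h : Derives Ax (⋃₀ c) X) :
    ∃ t ∈ c, Derives Ax t X := by
  induction h with
  | ax h => exact hne.imp fun t ht => ⟨ht, .ax h⟩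
  | hyp h => exact h.imp fun t ht => ⟨ht.1, .hyp ht.2⟩
  | mp _ _ ih ih' =>
    obtain ⟨s, hs, h⟩ := ih
    obtain ⟨t, ht, h'⟩ := ih'
    rcases hc.total hs ht with hst | hst
    · exact ⟨t, ht, .mp (h.mono hst) h'⟩
    · exact ⟨s, hs, .mp h (h'.mono hst)⟩

/-- Deductively closed sets of formulas that decide every conditional as a truth table does. -/
structure IsMaximalTheory (T : Set (Formula Atom)) : Prop where
  closed : ∀ {X}, Derives GT4Axiom T X → X ∈ T
  imp_iff : ∀ X Y, X.imp Y ∈ T ↔ (X ∈ T → Y ∈ T)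
  falsum : Formula.lam.neg ∉ T

theorem exists_isMaximalTheory (h : ¬ Derives GT4Axiom Γ X) :
    ∃ T, Γ ⊆ T ∧ IsMaximalTheory T ∧ X ∉ T := by
  obtain ⟨T, hΓ, hT⟩ := zorn_subset_nonempty {T | ¬ Derives GT4Axiom T X}
    (fun c hcS hc hne => ⟨⋃₀ c, fun hd => by
      obtain ⟨t, ht, h⟩ := hd.exists_mem_chain hc hne
      exact hcS ht h, fun _ => Set.subset_sUnion_of_mem⟩) Γ h
  have hX : ¬ Derives GT4Axiom T X := hT.prop
  -- `T` is maximal among the sets that do not derive `X`, so adding any new formula makes `X`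
  -- derivable.
  have hins : ∀ Y, Y ∉ T → Derives GT4Axiom T (Y.imp X) := fun Y hY => by
    by_contra hn
    exact hY (hT.le_of_ge (y := insert Y T) (fun h => hn (h.deduction GTScheme.gt4Axiom))
      (Set.subset_insert _ _) (Set.mem_insert _ _))
  have hcl : ∀ {Y}, Derives GT4Axiom T Y → Y ∈ T := fun {Y} hY => by
    by_contra hn
    exact hX (.mp hY (hins Y hn))
  refine ⟨T, hΓ, ⟨hcl, fun Y Z => ⟨fun h hY => hcl (.mp (.hyp hY) (.hyp h)), fun h => ?_⟩,
    fun h => hX (.mp (.hyp h) (.ax (GTScheme.ax5 _).gt4Axiom))⟩, fun h => hX (.hyp h)⟩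
  by_cases hY : Y ∈ T
  · exact hcl (.weaken GTScheme.gt4Axiom (.hyp (h hY)))
  by_contra hn
  -- Both `Y` and `Y ⊃ Z` lie outside `T`, so each implies `X` over `T`. Assuming `X ⊃ Z`, one gets
  -- `Y ⊃ X ⊃ Z`, hence `Y ⊃ Z`, hence `X`; Peirce's law discharges the assumption and contradicts
  -- the choice of `T`.
  have hZ : Derives GT4Axiom (insert (X.imp Z) T) (Y.imp Z) :=
    .deduction GTScheme.gt4Axiom <| .mp (.mp (.hyp (.inl rfl)) <|
      (hins Y hY).mono <| (Set.subset_insert _ _).trans (Set.subset_insert _ _))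
      (.hyp (.inr (.inl rfl)))
  exact hX <| .peirce GTScheme.gt4Axiom (Y := Z) <| .mp hZ ((hins _ hn).mono (Set.subset_insert _ _))

theorem IsMaximalTheory.mp (hT : IsMaximalTheory T) (h : X ∈ T)
    (hXY : Derives GT4Axiom ∅ (X.imp Y)) : Y ∈ T :=
  (hT.imp_iff X Y).1 (hT.closed (hXY.mono (Set.empty_subset _))) h

theorem IsMaximalTheory.strong_iff (hT : IsMaximalTheory T) : X.strong ∈ T ↔ X.neg ∉ T := by
  simp only [Formula.strong, Formula.cneg, hT.imp_iff, hT.falsum, imp_false]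

theorem IsMaximalTheory.of_strong (hT : IsMaximalTheory T) (h : X.strong ∈ T) : X ∈ T := by
  by_contra hX
  refine hT.strong_iff.1 h (hT.mp (X := X.cneg) ?_ (.ax (GTScheme.ax6 X).gt4Axiom))
  simpa only [Formula.cneg, hT.imp_iff, hT.falsum, imp_false]

theorem IsMaximalTheory.strong_of_derives (hT : IsMaximalTheory T)
    (h : Derives GT4Axiom {Y | Y.strong ∈ T} X) : X.strong ∈ T := by
  induction h with
  | ax h => exact hT.closed ((Derives.necessitation (.ax h)).mono (Set.empty_subset _))
  | hyp h => exact h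
  | mp _ _ ih ih' => exact hT.closed (.strong_mp (.hyp ih) (.hyp ih'))

variable (Atom) in
/-- The canonical frame of GT4. -/
def canonicalFrame : Frame {T : Set (Formula Atom) // IsMaximalTheory T} where
  rel M N := ∀ X : Formula Atom, X.strong ∈ M.1 → X ∈ N.1
  refl M _ h := M.2.of_strong h

theorem canonicalFrame_trans {M N P : {T : Set (Formula Atom) // IsMaximalTheory T}}
    (h : (canonicalFrame Atom).rel M N) (h' : (canonicalFrame Atom).rel N P) :
    (canonicalFrame Atom).rel M P :=
  fun X hX => h' X (h _ (M.2.mp hX .strong_strong))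

/-- The canonical model of GT4 with a given actual world. -/
def canonicalModel (M : {T : Set (Formula Atom) // IsMaximalTheory T}) :
    Model Atom (canonicalFrame Atom) where
  actual := M
  val N p := .atom p ∈ N.1

theorem canonicalModel_holds (M N : {T : Set (Formula Atom) // IsMaximalTheory T})
    (X : Formula Atom) : (canonicalModel M).holds N X ↔ X ∈ N.1 := by
  induction X generalizing N with
  | atom p => rfl
  | lam => exact iff_of_true trivial (N.2.closed (.ax (GTScheme.ax1).gt4Axiom))
  | imp X Y ihX ihY => rw [Model.holds_imp, ihX, ihY, N.2.imp_iff]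
  | neg X ih =>
    simp only [Model.holds_neg, ih]
    refine ⟨fun ⟨P, hP, h⟩ => ?_, fun h => ?_⟩
    · by_contra hn
      exact h (hP X (N.2.strong_iff.2 hn))
    -- The witness world extends all `Y` with `+Y` in `N` and omits `X`. It exists because a
    -- derivation of `X` from those `Y` would put `+X` in `N`.
    · have hX : ¬ Derives GT4Axiom {Y | Y.strong ∈ N.1} X := fun hd =>
        N.2.strong_iff.1 (N.2.strong_of_derives hd) h
      obtain ⟨P, hP, hPT, hXP⟩ := exists_isMaximalTheory hX
      exact ⟨⟨P, hPT⟩, fun Y hY => hP hY, hXP⟩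

/-- `Y` is true wherever `X` is, in all models with transitive accessibility. -/
def TransitiveEntails (X Y : Formula Atom) : Prop :=
  ∀ (S : Type u) (F : Frame S), (∀ M N P : S, F.rel M N → F.rel N P → F.rel M P) →
    ∀ (Mo : Model Atom F) (M : S), Mo.holds M X → Mo.holds M Y

theorem TransitiveEntails.consequence4 (h : TransitiveEntails X Y) : Consequence4 X Y := by
  by_contra hn
  obtain ⟨T, hXT, hT, hY⟩ := exists_isMaximalTheory hn
  let M : {T : Set (Formula Atom) // IsMaximalTheory T} := ⟨T, hT⟩
  refine hY ((canonicalModel_holds M M Y).1 (h _ _ (fun _ _ _ => canonicalFrame_trans) _ _ ?_))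
  exact (canonicalModel_holds M M X).2 (hXT rfl)

theorem consequence4_lam : Consequence4 .lam X ↔ TT4 X :=
  ⟨fun h => .mp (.ax (GTScheme.ax1).gt4Axiom)
      (.deduction GTScheme.gt4Axiom (h.mono fun _ => .inl)),
    fun h => h.mono (Set.empty_subset _)⟩

end Completeness

end ExGraph

namespace ExGraph

/-! ### Truth of graphs and soundness of GET4 -/

section Soundness

variable {Atom : Type u} {S : Type v} {F : Frame S}

/-- Truth of a graph in a world of a model. -/
def Model.sat (Mo : Model Atom F) : S → Graph Atom → Prop
  | M, .atom p => Mo.val M p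
  | _, .blank => True
  | M, .juxt G H => Mo.sat M G ∧ Mo.sat M H
  | M, .cut G => ¬ Mo.sat M G
  | M, .broken G => ∃ P, F.rel M P ∧ ¬ Mo.sat P G

theorem Model.sat_star (Mo : Model Atom F) (M : S) (G : Graph Atom) :
    Mo.sat M G.star ↔ ∀ P, F.rel M P → Mo.sat P G := by
  simp [Graph.star, Model.sat]

theorem ToGraph.holds_iff {X : Formula Atom} {G : Graph Atom} (h : ToGraph X G)
    (Mo : Model Atom F) (M : S) : Mo.holds M X ↔ Mo.sat M G := by
  induction h generalizing M with
  | atom p => rfl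
  | lam => rfl
  | neg _ ih => simp [Model.sat, ih]
  | imp _ _ ih ih' => simp [Graph.cond, Model.sat, ih, ih']
  | or _ _ ih ih' => simp [Model.sat, ih, ih', or_iff_not_imp_left]
  | and _ _ ih ih' => simp [Model.sat, ih, ih']
  | cneg _ ih => simp [Model.sat, ih]

theorem ToFormula.holds_iff {X : Formula Atom} {G : Graph Atom} (h : ToFormula G X)
    (Mo : Model Atom F) (M : S) : Mo.holds M X ↔ Mo.sat M G := by
  induction h generalizing M with
  | atom p => rfl
  | blank => rfl
  | cond _ _ ih ih' => simp [Graph.cond, Model.sat, ih, ih']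
  | disj _ _ ih ih' => simp [Model.sat, ih, ih', or_iff_not_imp_left]
  | cut _ ih => simp [Model.sat, ih]
  | broken _ ih => simp [Model.sat, ih]
  | juxt _ _ ih ih' => simp [Model.sat, ih, ih']

variable {Mo : Model Atom F} {X Y : Graph Atom}

/-! ### Truth of a graph as a function of the content of one region -/

theorem Model.sat_fill_mono {X Y : Graph Atom} (h : ∀ M, Mo.sat M X → Mo.sat M Y) (K : Ctx Atom) :
    (K.IsEven → ∀ M, Mo.sat M (K.fill X) → Mo.sat M (K.fill Y)) ∧
      (K.IsOdd → ∀ M, Mo.sat M (K.fill Y) → Mo.sat M (K.fill X)) := by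
  induction K with
  | hole => exact ⟨fun _ => h, fun hK => by simp [Ctx.IsOdd, Ctx.cuts, Ctx.brokenCuts] at hK⟩
  | juxtL K G ih =>
    exact ⟨fun hK M hM => ⟨ih.1 hK M hM.1, hM.2⟩, fun hK M hM => ⟨ih.2 hK M hM.1, hM.2⟩⟩
  | juxtR G K ih =>
    exact ⟨fun hK M hM => ⟨hM.1, ih.1 hK M hM.2⟩, fun hK M hM => ⟨hM.1, ih.2 hK M hM.2⟩⟩
  | cut K ih =>
    have hs : (Ctx.cut K).cuts + (Ctx.cut K).brokenCuts = K.cuts + K.brokenCuts + 1 := by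
      simp only [Ctx.cuts, Ctx.brokenCuts]; omega
    refine ⟨fun hK M hM hX => hM (ih.2 ?_ M hX), fun hK M hM hX => hM (ih.1 ?_ M hX)⟩
    · rwa [Ctx.IsEven, hs, Nat.even_add_one, Nat.not_even_iff_odd] at hK
    · rwa [Ctx.IsOdd, hs, Nat.odd_add_one, Nat.not_odd_iff_even] at hK
  | broken K ih =>
    have hs : (Ctx.broken K).cuts + (Ctx.broken K).brokenCuts = K.cuts + K.brokenCuts + 1 := rfl
    refine ⟨fun hK M ⟨P, hP, hM⟩ => ⟨P, hP, fun hX => hM (ih.2 ?_ P hX)⟩,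
      fun hK M ⟨P, hP, hM⟩ => ⟨P, hP, fun hX => hM (ih.1 ?_ P hX)⟩⟩
    · rwa [Ctx.IsEven, hs, Nat.even_add_one, Nat.not_even_iff_odd] at hK
    · rwa [Ctx.IsOdd, hs, Nat.odd_add_one, Nat.not_odd_iff_even] at hK

theorem Model.sat_fill_congr (h : ∀ M, Mo.sat M X ↔ Mo.sat M Y) (K : Ctx Atom) (M : S) :
    Mo.sat M (K.fill X) ↔ Mo.sat M (K.fill Y) := by
  induction K generalizing M with
  | hole => exact h M
  | juxtL K G ih => simp [Ctx.fill, Model.sat, ih]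
  | juxtR G K ih => simp [Ctx.fill, Model.sat, ih]
  | cut K ih => simp [Ctx.fill, Model.sat, ih]
  | broken K ih => simp [Ctx.fill, Model.sat, ih]

/-- Only broken cuts change the world of evaluation, so agreement at `M` alone is enough. -/
theorem Model.sat_fill_congr_of_cuts (C : Ctx Atom) (hC : C.brokenCuts = 0) {M : S}
    (h : Mo.sat M X ↔ Mo.sat M Y) : Mo.sat M (C.fill X) ↔ Mo.sat M (C.fill Y) := by
  induction C with
  | hole => exact h
  | juxtL C G ih => simp [Ctx.fill, Model.sat, ih hC]
  | juxtR G C ih => simp [Ctx.fill, Model.sat, ih hC]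
  | cut C ih => simp [Ctx.fill, Model.sat, ih hC]
  | broken C ih => simp [Ctx.brokenCuts] at hC

theorem Model.sat_fill_congr_of_broken (C : Ctx Atom) (hC : C.brokenCuts = 1) {M : S}
    (h : ∀ P, F.rel M P → (Mo.sat P X ↔ Mo.sat P Y)) :
    Mo.sat M (C.fill X) ↔ Mo.sat M (C.fill Y) := by
  induction C with
  | hole => simp [Ctx.brokenCuts] at hC
  | juxtL C G ih => simp [Ctx.fill, Model.sat, ih hC]
  | juxtR G C ih => simp [Ctx.fill, Model.sat, ih hC]
  | cut C ih => simp [Ctx.fill, Model.sat, ih hC]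
  | broken C ih =>
    have hC' : C.brokenCuts = 0 := by simpa [Ctx.brokenCuts] using hC
    exact exists_congr fun P => and_congr_right fun hP =>
      not_congr (sat_fill_congr_of_cuts C hC' (h P hP))

/-- Each broken cut moves one step along accessibility; by transitivity and reflexivity the region
is always evaluated at worlds accessible from `M`, however many broken cuts surround it. -/
theorem Model.sat_fill_congr_of_trans (hF : ∀ M N P : S, F.rel M N → F.rel N P → F.rel M P)
    (C : Ctx Atom) {M : S} (h : ∀ P, F.rel M P → (Mo.sat P X ↔ Mo.sat P Y)) :
    Mo.sat M (C.fill X) ↔ Mo.sat M (C.fill Y) := by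
  induction C generalizing M with
  | hole => exact h M (F.refl M)
  | juxtL C G ih => simp [Ctx.fill, Model.sat, ih h]
  | juxtR G C ih => simp [Ctx.fill, Model.sat, ih h]
  | cut C ih => simp [Ctx.fill, Model.sat, ih h]
  | broken C ih =>
    exact exists_congr fun P => and_congr_right fun hP =>
      not_congr (ih fun Q hQ => h Q (hF _ _ _ hP hQ))

theorem Model.sat_iter (C : Ctx Atom) (hC : C.brokenCuts = 0) (M : S) :
    Mo.sat M (.juxt Y (C.fill X)) ↔ Mo.sat M (.juxt Y (C.fill (.juxt X Y))) :=
  and_congr_right fun hY => sat_fill_congr_of_cuts C hC (and_iff_left hY).symm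

theorem Model.sat_iterBroken (C : Ctx Atom) (hC : C.brokenCuts = 1) (M : S) :
    Mo.sat M (.juxt Y.star (C.fill X)) ↔ Mo.sat M (.juxt Y.star (C.fill (.juxt X Y))) :=
  and_congr_right fun hY => sat_fill_congr_of_broken C hC fun P hP =>
    (and_iff_left ((sat_star Mo M Y).1 hY P hP)).symm

theorem Model.sat_strongIter (hF : ∀ M N P : S, F.rel M N → F.rel N P → F.rel M P)
    (C : Ctx Atom) (M : S) :
    Mo.sat M (.juxt Y.star (C.fill X)) ↔ Mo.sat M (.juxt Y.star (C.fill (.juxt Y.star X))) :=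
  and_congr_right fun hY => sat_fill_congr_of_trans hF C fun P hP =>
    (and_iff_right ((sat_star Mo P Y).2 fun Q hQ =>
      (sat_star Mo M Y).1 hY Q (hF _ _ _ hP hQ))).symm

theorem GETStep.sound {G H : Graph Atom} (h : GETStep G H) (M : S) :
    Mo.sat M G → Mo.sat M H := by
  cases h with
  | strongDoubleCut K =>
    exact (Model.sat_fill_congr (fun M => by simp [Model.sat_star, Model.sat]) K M).1
  | erase K X Y hK => exact (Model.sat_fill_mono (X := .juxt X Y) (Y := X) (fun M h => h.1) K).1 hK M
  | write K X Y hK => exact (Model.sat_fill_mono (X := .juxt X Y) (Y := X) (fun M h => h.1) K).2 hK M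
  | iter K C X Y hC => exact (Model.sat_fill_congr (Model.sat_iter C hC) K M).1
  | deiter K C X Y hC => exact (Model.sat_fill_congr (Model.sat_iter C hC) K M).2
  | dup K X => exact (Model.sat_fill_congr (fun M => by simp [Model.sat]) K M).1
  | undup K X => exact (Model.sat_fill_congr (fun M => by simp [Model.sat]) K M).1
  | iterBroken K C X Y hC => exact (Model.sat_fill_congr (Model.sat_iterBroken C hC) K M).1
  | deiterBroken K C X Y hC => exact (Model.sat_fill_congr (Model.sat_iterBroken C hC) K M).2
  | breakCut K X hK => exact (Model.sat_fill_mono (X := .cut X) (Y := .broken X)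
      (fun M h => ⟨M, F.refl M, h⟩) K).1 hK M
  | completeCut K X hK => exact (Model.sat_fill_mono (X := .cut X) (Y := .broken X)
      (fun M h => ⟨M, F.refl M, h⟩) K).2 hK M
  | eraseDoubleCut K X hK => exact (Model.sat_fill_mono (X := .cut (.cut X)) (Y := X)
      (fun M h => not_not.1 h) K).1 hK M
  | writeDoubleCut K X hK => exact (Model.sat_fill_mono (X := .cut (.cut X)) (Y := X)
      (fun M h => not_not.1 h) K).2 hK M
  | comm K X Y => exact (Model.sat_fill_congr (X := .juxt X Y) (Y := .juxt Y X)
      (fun M => and_comm) K M).1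
  | assoc K X Y Z => exact (Model.sat_fill_congr (X := .juxt (.juxt X Y) Z) (Y := .juxt X (.juxt Y Z))
      (fun M => and_assoc) K M).1
  | unassoc K X Y Z => exact (Model.sat_fill_congr (X := .juxt (.juxt X Y) Z) (Y := .juxt X (.juxt Y Z))
      (fun M => and_assoc) K M).2
  | addBlank K X => exact (Model.sat_fill_congr (fun M => by simp [Model.sat]) K M).1
  | dropBlank K X => exact (Model.sat_fill_congr (fun M => by simp [Model.sat]) K M).1

theorem Transforms4.sound (hF : ∀ M N P : S, F.rel M N → F.rel N P → F.rel M P)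
    {G H : Graph Atom} (h : Transforms4 G H) (M : S) (hG : Mo.sat M G) : Mo.sat M H := by
  induction h with
  | refl => exact hG
  | tail _ hs ih =>
    cases hs with
    | ofGET hs => exact hs.sound M ih
    | strongIter K C X Y _ =>
      exact (Model.sat_fill_congr (Model.sat_strongIter hF C) K M).1 ih
    | strongDeiter K C X Y _ =>
      exact (Model.sat_fill_congr (Model.sat_strongIter hF C) K M).2 ih

end Soundness

end ExGraph

namespace ExGraph

/-! ### The calculus of graphs -/

section Calculus

variable {Atom : Type u}

/-- Put one context into the marked region of another. -/
def Ctx.comp : Ctx Atom → Ctx Atom → Ctx Atom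
  | .hole, C => C
  | .juxtL K G, C => .juxtL (K.comp C) G
  | .juxtR G K, C => .juxtR G (K.comp C)
  | .cut K, C => .cut (K.comp C)
  | .broken K, C => .broken (K.comp C)

theorem Ctx.comp_fill (K C : Ctx Atom) (X : Graph Atom) :
    (K.comp C).fill X = K.fill (C.fill X) := by
  induction K with
  | hole => rfl
  | juxtL K G ih => simp [Ctx.comp, Ctx.fill, ih]
  | juxtR G K ih => simp [Ctx.comp, Ctx.fill, ih]
  | cut K ih => simp [Ctx.comp, Ctx.fill, ih]
  | broken K ih => simp [Ctx.comp, Ctx.fill, ih]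

theorem Ctx.comp_cuts (K C : Ctx Atom) :
    (K.comp C).cuts + (K.comp C).brokenCuts =
      (K.cuts + K.brokenCuts) + (C.cuts + C.brokenCuts) := by
  induction K with
  | hole => simp [Ctx.comp, Ctx.cuts, Ctx.brokenCuts]
  | juxtL K G ih => exact ih
  | juxtR G K ih => exact ih
  | cut K ih => simp only [Ctx.comp, Ctx.cuts, Ctx.brokenCuts]; omega
  | broken K ih => simp only [Ctx.comp, Ctx.cuts, Ctx.brokenCuts]; omega

variable {K C : Ctx Atom}

theorem Ctx.IsEven.comp_even (hK : K.IsEven) (hC : C.IsEven) : (K.comp C).IsEven := by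
  rw [IsEven, comp_cuts]; exact Even.add hK hC

theorem Ctx.IsEven.comp_odd (hK : K.IsEven) (hC : C.IsOdd) : (K.comp C).IsOdd := by
  rw [IsOdd, comp_cuts]; exact Even.add_odd hK hC

theorem Ctx.IsOdd.comp_even (hK : K.IsOdd) (hC : C.IsEven) : (K.comp C).IsOdd := by
  rw [IsOdd, comp_cuts]; exact Odd.add_even hK hC

theorem Ctx.IsOdd.comp_odd (hK : K.IsOdd) (hC : C.IsOdd) : (K.comp C).IsEven := by
  rw [IsEven, comp_cuts]; exact Odd.add_odd hK hC

theorem Ctx.isEven_hole : (hole : Ctx Atom).IsEven := ⟨0, rfl⟩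

theorem Ctx.isOdd_cut_hole : (cut hole : Ctx Atom).IsOdd := ⟨0, rfl⟩

theorem Ctx.isOdd_broken_hole : (broken hole : Ctx Atom).IsOdd := ⟨0, rfl⟩

variable {G G' H H' X Y Z : Graph Atom}

theorem GETStep.transforms4 (h : GETStep G H) : Transforms4 G H := .single (.ofGET h)

theorem GET4Step.transforms4 (h : GET4Step G H) : Transforms4 G H := .single h

theorem Transforms4.refl (G : Graph Atom) : Transforms4 G G := Relation.ReflTransGen.refl

theorem Transforms4.trans (h : Transforms4 G H) (h' : Transforms4 H X) : Transforms4 G X :=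
  Relation.ReflTransGen.trans h h'

theorem GET4Step.fill_even (hK : K.IsEven) (h : GET4Step G H) :
    GET4Step (K.fill G) (K.fill H) := by
  cases h with
  | ofGET h =>
    refine .ofGET ?_
    cases h with
    | strongDoubleCut K' =>
      simpa only [Ctx.comp_fill] using GETStep.strongDoubleCut (K.comp K')
    | erase K' X Y h =>
      simpa only [Ctx.comp_fill] using GETStep.erase (K.comp K') X Y (hK.comp_even h)
    | write K' X Y h =>
      simpa only [Ctx.comp_fill] using GETStep.write (K.comp K') X Y (hK.comp_odd h)
    | iter K' C X Y h =>
      simpa only [Ctx.comp_fill] using GETStep.iter (K.comp K') C X Y h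
    | deiter K' C X Y h =>
      simpa only [Ctx.comp_fill] using GETStep.deiter (K.comp K') C X Y h
    | dup K' X =>
      simpa only [Ctx.comp_fill] using GETStep.dup (K.comp K') X
    | undup K' X =>
      simpa only [Ctx.comp_fill] using GETStep.undup (K.comp K') X
    | iterBroken K' C X Y h =>
      simpa only [Ctx.comp_fill] using GETStep.iterBroken (K.comp K') C X Y h
    | deiterBroken K' C X Y h =>
      simpa only [Ctx.comp_fill] using GETStep.deiterBroken (K.comp K') C X Y h
    | breakCut K' X h =>
      simpa only [Ctx.comp_fill] using GETStep.breakCut (K.comp K') X (hK.comp_even h)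
    | completeCut K' X h =>
      simpa only [Ctx.comp_fill] using GETStep.completeCut (K.comp K') X (hK.comp_odd h)
    | eraseDoubleCut K' X h =>
      simpa only [Ctx.comp_fill] using GETStep.eraseDoubleCut (K.comp K') X (hK.comp_even h)
    | writeDoubleCut K' X h =>
      simpa only [Ctx.comp_fill] using GETStep.writeDoubleCut (K.comp K') X (hK.comp_odd h)
    | comm K' X Y =>
      simpa only [Ctx.comp_fill] using GETStep.comm (K.comp K') X Y
    | assoc K' X Y Z =>
      simpa only [Ctx.comp_fill] using GETStep.assoc (K.comp K') X Y Z
    | unassoc K' X Y Z =>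
      simpa only [Ctx.comp_fill] using GETStep.unassoc (K.comp K') X Y Z
    | addBlank K' X =>
      simpa only [Ctx.comp_fill] using GETStep.addBlank (K.comp K') X
    | dropBlank K' X =>
      simpa only [Ctx.comp_fill] using GETStep.dropBlank (K.comp K') X
  | strongIter K' C X Y h =>
    simpa only [Ctx.comp_fill] using GET4Step.strongIter (K.comp K') C X Y h
  | strongDeiter K' C X Y h =>
    simpa only [Ctx.comp_fill] using GET4Step.strongDeiter (K.comp K') C X Y h

theorem Transforms4.fill_even (hK : K.IsEven) (h : Transforms4 G H) :
    Transforms4 (K.fill G) (K.fill H) :=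
  Relation.ReflTransGen.lift K.fill (fun _ _ => GET4Step.fill_even hK) _ _ h

theorem Transforms4.juxt_left (h : Transforms4 G H) (X : Graph Atom) :
    Transforms4 (.juxt G X) (.juxt H X) :=
  h.fill_even (K := .juxtL .hole X) (Ctx.isEven_hole (Atom := Atom))

theorem Transforms4.juxt_right (X : Graph Atom) (h : Transforms4 G H) :
    Transforms4 (.juxt X G) (.juxt X H) :=
  h.fill_even (K := .juxtR X .hole) (Ctx.isEven_hole (Atom := Atom))

theorem Transforms4.comm (G H : Graph Atom) : Transforms4 (.juxt G H) (.juxt H G) :=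
  (GETStep.comm .hole G H).transforms4

theorem Transforms4.left (G H : Graph Atom) : Transforms4 (.juxt G H) G :=
  (GETStep.erase .hole G H Ctx.isEven_hole).transforms4

theorem Transforms4.right (G H : Graph Atom) : Transforms4 (.juxt G H) H :=
  (comm G H).trans (left H G)

theorem Transforms4.pair (h : Transforms4 G X) (h' : Transforms4 G Y) :
    Transforms4 G (.juxt X Y) :=
  (GETStep.dup .hole G).transforms4.trans ((h.juxt_left G).trans (h'.juxt_right X))

theorem Transforms4.blank (G : Graph Atom) : Transforms4 G .blank :=
  (GETStep.addBlank .hole G).transforms4.trans (right _ _)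

/-- The strong empty graph may be erased in any region. -/
theorem Transforms4.fill_star_blank (K : Ctx Atom) :
    Transforms4 (K.fill (Graph.star .blank)) (K.fill .blank) := by
  -- R1 supplies a second `*λ` outside the whole graph. It licenses removal of the inner one: by
  -- plain deiteration if no broken cut intervenes, by strong deiteration otherwise.
  have h : ∀ G : Graph Atom, Transforms4 G (.juxt (Graph.star .blank) G) := fun G =>
    pair ((blank G).trans (GETStep.strongDoubleCut .hole).transforms4) (refl G)
  refine (GETStep.addBlank K (Graph.star .blank)).transforms4.trans <| (h _).trans (.trans ?_ (right (Graph.star .blank) _))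
  rcases Nat.eq_zero_or_pos K.brokenCuts with h0 | h0
  · exact ((GETStep.comm K _ _).transforms4.juxt_right _).trans
      (GETStep.deiter .hole K _ _ h0).transforms4
  · exact .single (.strongDeiter .hole K _ _ h0)

/-- Every rule is paired with its inverse at opposite parity or in all regions, except R1, whose
inverse is the derived rule `Transforms4.fill_star_blank`. -/
theorem GET4Step.fill_odd (hK : K.IsOdd) (h : GET4Step G H) :
    Transforms4 (K.fill H) (K.fill G) := by
  cases h with
  | ofGET h =>
    cases h with
    | strongDoubleCut K' =>
      simpa only [Ctx.comp_fill] using Transforms4.fill_star_blank (K.comp K')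
    | erase K' X Y h =>
      simpa only [Ctx.comp_fill] using (GETStep.write (K.comp K') X Y (hK.comp_even h)).transforms4
    | write K' X Y h =>
      simpa only [Ctx.comp_fill] using (GETStep.erase (K.comp K') X Y (hK.comp_odd h)).transforms4
    | iter K' C X Y h =>
      simpa only [Ctx.comp_fill] using (GETStep.deiter (K.comp K') C X Y h).transforms4
    | deiter K' C X Y h =>
      simpa only [Ctx.comp_fill] using (GETStep.iter (K.comp K') C X Y h).transforms4
    | dup K' X => simpa only [Ctx.comp_fill] using (GETStep.undup (K.comp K') X).transforms4
    | undup K' X => simpa only [Ctx.comp_fill] using (GETStep.dup (K.comp K') X).transforms4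
    | iterBroken K' C X Y h =>
      simpa only [Ctx.comp_fill] using (GETStep.deiterBroken (K.comp K') C X Y h).transforms4
    | deiterBroken K' C X Y h =>
      simpa only [Ctx.comp_fill] using (GETStep.iterBroken (K.comp K') C X Y h).transforms4
    | breakCut K' X h =>
      simpa only [Ctx.comp_fill] using
        (GETStep.completeCut (K.comp K') X (hK.comp_even h)).transforms4
    | completeCut K' X h =>
      simpa only [Ctx.comp_fill] using (GETStep.breakCut (K.comp K') X (hK.comp_odd h)).transforms4
    | eraseDoubleCut K' X h =>
      simpa only [Ctx.comp_fill] using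
        (GETStep.writeDoubleCut (K.comp K') X (hK.comp_even h)).transforms4
    | writeDoubleCut K' X h =>
      simpa only [Ctx.comp_fill] using
        (GETStep.eraseDoubleCut (K.comp K') X (hK.comp_odd h)).transforms4
    | comm K' X Y => simpa only [Ctx.comp_fill] using (GETStep.comm (K.comp K') Y X).transforms4
    | assoc K' X Y Z =>
      simpa only [Ctx.comp_fill] using (GETStep.unassoc (K.comp K') X Y Z).transforms4
    | unassoc K' X Y Z =>
      simpa only [Ctx.comp_fill] using (GETStep.assoc (K.comp K') X Y Z).transforms4
    | addBlank K' X =>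
      simpa only [Ctx.comp_fill] using (GETStep.dropBlank (K.comp K') X).transforms4
    | dropBlank K' X =>
      simpa only [Ctx.comp_fill] using (GETStep.addBlank (K.comp K') X).transforms4
  | strongIter K' C X Y h =>
    simpa only [Ctx.comp_fill] using (GET4Step.strongDeiter (K.comp K') C X Y h).transforms4
  | strongDeiter K' C X Y h =>
    simpa only [Ctx.comp_fill] using (GET4Step.strongIter (K.comp K') C X Y h).transforms4

theorem Transforms4.fill_odd (hK : K.IsOdd) (h : Transforms4 G H) :
    Transforms4 (K.fill H) (K.fill G) := by
  induction h with
  | refl => exact refl _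
  | tail _ hs ih => exact (hs.fill_odd hK).trans ih

/-! ### Derived rules of the graph calculus -/

theorem Transforms4.cut (h : Transforms4 G H) : Transforms4 (.cut H) (.cut G) :=
  h.fill_odd Ctx.isOdd_cut_hole

theorem Transforms4.broken (h : Transforms4 G H) : Transforms4 (.broken H) (.broken G) :=
  h.fill_odd Ctx.isOdd_broken_hole

theorem Transforms4.star (h : Transforms4 G H) : Transforms4 G.star H.star := h.broken.cut

theorem Transforms4.of_cut_cut (G : Graph Atom) : Transforms4 (.cut (.cut G)) G :=
  (GETStep.eraseDoubleCut .hole G Ctx.isEven_hole).transforms4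

theorem Transforms4.cut_cut_blank : Transforms4 (.blank : Graph Atom) (.cut (.cut .blank)) :=
  (GETStep.strongDoubleCut .hole).transforms4.trans
    (GETStep.completeCut (.cut .hole) _ Ctx.isOdd_cut_hole).transforms4

/-- R6 writes double cuts only in odd regions. Here an empty double cut comes from R1 and R4, and
`G` is iterated into it. -/
theorem Transforms4.cut_cut (G : Graph Atom) : Transforms4 G (.cut (.cut G)) :=
  (pair (refl G) ((blank G).trans cut_cut_blank)).trans <|
    (GETStep.iter .hole (.cut (.cut .hole)) .blank G rfl).transforms4.trans <|
      (right _ _).trans (right _ _).cut.cut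

theorem Transforms4.cond_right (X : Graph Atom) (h : Transforms4 G H) :
    Transforms4 (Graph.cond X G) (Graph.cond X H) :=
  (h.cut.juxt_right X).cut

theorem Transforms4.cond_refl (G : Graph Atom) : Transforms4 .blank (Graph.cond G G) :=
  cut_cut_blank.trans <| (right G _).cut.trans <| cut <|
    ((right .blank G).cut.juxt_right G).trans
      (GETStep.deiter .hole (.cut .hole) .blank G rfl).transforms4

/-- The deduction theorem for graphs: write `(X(X))` beside `G`, iterate `G` into the inner cut, and
apply the hypothesis there, the region being even. -/
theorem Transforms4.curry (h : Transforms4 (.juxt G X) Y) : Transforms4 G (Graph.cond X Y) :=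
  (pair (refl G) ((blank G).trans (cond_refl X))).trans <|
    (GETStep.iter .hole (.cut (.juxtR X (.cut .hole))) X G rfl).transforms4.trans <|
      (right _ _).trans (cond_right X ((comm X G).trans h))

theorem Transforms4.mp (h : Transforms4 G X) (h' : Transforms4 G (Graph.cond X Y)) :
    Transforms4 G Y :=
  (pair h (h'.trans (comm _ _).cut)).trans <|
    (GETStep.deiter .hole (.cut .hole) (.cut Y) X rfl).transforms4.trans <|
      (right _ _).trans (of_cut_cut Y)

theorem Transforms4.by_contra (h : Transforms4 (.juxt G (.cut X)) X) : Transforms4 G X :=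
  h.curry.trans <| (GETStep.dup .hole (.cut X)).transforms4.cut.trans (of_cut_cut X)

theorem Transforms4.cond_of_cut (X Y : Graph Atom) :
    Transforms4 (.cut X) (Graph.cond X Y) := (left X _).cut

theorem Transforms4.falsum (G : Graph Atom) : Transforms4 (.broken .blank) G := by
  -- R1 adds `({λ})`, from which the outer `{λ}` deiterates the inner one, leaving the empty cut.
  have h : Transforms4 (.broken .blank) (.cut (.blank : Graph Atom)) :=
    (pair (refl _) ((blank _).trans (GETStep.strongDoubleCut .hole).transforms4)).trans <|
      (pair (left _ _) ((right _ _).trans (right .blank _).cut)).trans <|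
        (GETStep.deiter .hole (.cut .hole) .blank (.broken .blank) rfl).transforms4.trans
          (right _ _)
  exact h.trans ((blank (.cut G)).cut.trans (of_cut_cut G))

/-- `*X` lets `X` be iterated through the one broken cut of `*Y`. This is the graphical content of
scheme (7). -/
theorem Transforms4.star_pair (h : Transforms4 (.juxt X Y) Z) :
    Transforms4 (.juxt X.star Y.star) Z.star :=
  (GETStep.iterBroken .hole (.cut (.broken .hole)) Y X rfl).transforms4.trans <|
    (right _ _).trans ((comm Y X).trans h).star

theorem Transforms4.necessitation (h : Transforms4 .blank G) : Transforms4 .blank G.star :=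
  (GETStep.strongDoubleCut .hole).transforms4.trans h.star

/-- Graphs that can be transformed into each other. -/
def GraphEquiv (G H : Graph Atom) : Prop := Transforms4 G H ∧ Transforms4 H G

theorem GraphEquiv.refl (G : Graph Atom) : GraphEquiv G G := ⟨.refl G, .refl G⟩

theorem GraphEquiv.symm (h : GraphEquiv G H) : GraphEquiv H G := ⟨h.2, h.1⟩

theorem GraphEquiv.trans (h : GraphEquiv G H) (h' : GraphEquiv H X) : GraphEquiv G X :=
  ⟨h.1.trans h'.1, h'.2.trans h.2⟩

theorem GraphEquiv.juxt (h : GraphEquiv G G') (h' : GraphEquiv H H') :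
    GraphEquiv (.juxt G H) (.juxt G' H') :=
  ⟨(h.1.juxt_left H).trans (h'.1.juxt_right G'), (h.2.juxt_left H').trans (h'.2.juxt_right G)⟩

theorem GraphEquiv.cut (h : GraphEquiv G H) : GraphEquiv (.cut G) (.cut H) := ⟨h.2.cut, h.1.cut⟩

theorem GraphEquiv.broken (h : GraphEquiv G H) : GraphEquiv (.broken G) (.broken H) :=
  ⟨h.2.broken, h.1.broken⟩

theorem GraphEquiv.cond (h : GraphEquiv G G') (h' : GraphEquiv H H') :
    GraphEquiv (Graph.cond G H) (Graph.cond G' H') := (h.juxt h'.cut).cut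

theorem GraphEquiv.cut_cut (G : Graph Atom) : GraphEquiv (.cut (.cut G)) G :=
  ⟨.of_cut_cut G, .cut_cut G⟩

theorem GraphEquiv.cond_falsum (G : Graph Atom) :
    GraphEquiv (Graph.cond G (.broken .blank)) (.cut G) :=
  cut ⟨.left _ _, .pair (.refl G) ((Transforms4.blank G).trans
    (GETStep.strongDoubleCut .hole).transforms4)⟩

/-! ### Simulation of GT4 by GET4 -/

/-- The translation of formulas that treats all abbreviations as conditionals. -/
def Formula.graph : Formula Atom → Graph Atom
  | .atom p => .atom p
  | .lam => .blank
  | .neg X => .broken X.graph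
  | .imp X Y => Graph.cond X.graph Y.graph

theorem Formula.graph_cneg (X : Formula Atom) : GraphEquiv X.cneg.graph (.cut X.graph) :=
  .cond_falsum _

theorem Formula.graph_strong (X : Formula Atom) : GraphEquiv X.strong.graph X.graph.star :=
  .cond_falsum _

theorem Formula.graph_or (X Y : Formula Atom) :
    GraphEquiv (X.or Y).graph (.cut (.juxt (.cut X.graph) (.cut Y.graph))) :=
  X.graph_cneg.cond (.refl _)

theorem Formula.graph_and (X Y : Formula Atom) :
    GraphEquiv (X.and Y).graph (.juxt X.graph Y.graph) :=
  (graph_cneg _).trans <| (GraphEquiv.cut_cut _).trans <|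
    (GraphEquiv.refl _).juxt (Y.graph_cneg.cut.trans (.cut_cut _))

/-- The choice of clauses matters only up to double cuts and occurrences of `({λ})`, both of which
can be written and erased. -/
theorem ToGraph.equiv {X : Formula Atom} (h : ToGraph X G) : GraphEquiv G X.graph := by
  induction h with
  | atom p => exact .refl _
  | lam => exact .refl _
  | neg _ ih => exact ih.broken
  | imp _ _ ih ih' => exact ih.cond ih'
  | or _ _ ih ih' => exact (ih.cut.juxt ih'.cut).cut.trans (Formula.graph_or _ _).symm
  | and _ _ ih ih' => exact (ih.juxt ih').trans (Formula.graph_and _ _).symm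
  | cneg _ ih => exact ih.cut.trans (Formula.graph_cneg _).symm

theorem ToFormula.equiv {X : Formula Atom} (h : ToFormula G X) : GraphEquiv G X.graph := by
  induction h with
  | atom p => exact .refl _
  | blank => exact .refl _
  | cond _ _ ih ih' => exact ih.cond ih'
  | disj _ _ ih ih' => exact (ih.cut.juxt ih'.cut).cut.trans (Formula.graph_or _ _).symm
  | cut _ ih => exact ih.cut.trans (Formula.graph_cneg _).symm
  | broken _ ih => exact ih.broken
  | juxt _ _ ih ih' => exact (ih.juxt ih').trans (Formula.graph_and _ _).symm

theorem GTScheme.graph {X : Formula Atom} (h : GTScheme X) : Transforms4 .blank X.graph := by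
  cases h with
  | ax1 => exact .refl _
  | ax2 X Y => exact .curry (.curry ((Transforms4.left _ _).trans (.right _ _)))
  | ax3 X Y Z =>
    refine .curry (.curry (.curry ?_))
    have hX := Transforms4.right (.juxt (.juxt .blank (X.imp (Y.imp Z)).graph)
      (X.imp Y).graph) X.graph
    exact .mp (.mp hX ((Transforms4.left _ _).trans (.right _ _)))
      (.mp hX ((Transforms4.left _ _).trans ((Transforms4.left _ _).trans (.right _ _))))
  | ax4 X Y =>
    -- From `(X)` one gets `(X(Y))` by writing `(Y)` in the odd region; the premise then yields `X`.
    exact .curry (.by_contra (.mp ((Transforms4.right _ _).trans (.cond_of_cut _ _))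
      ((Transforms4.left _ _).trans (.right _ _))))
  | ax5 Z => exact .curry ((Transforms4.right _ _).trans (.falsum _))
  | ax6 X =>
    exact .curry <| (Transforms4.right _ _).trans <| X.graph_cneg.1.trans
      (GETStep.breakCut .hole X.graph Ctx.isEven_hole).transforms4
  | ax7 X Y =>
    refine .curry (.curry (Transforms4.trans ?_ Y.graph_strong.2))
    refine .trans (.pair ((Transforms4.left _ _).trans ((Transforms4.right _ _).trans
      (X.imp Y).graph_strong.1)) ((Transforms4.right _ _).trans X.graph_strong.1)) ?_
    exact .star_pair (.mp (.right _ _) (.left _ _))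

theorem Formula.graph_four (X Y : Formula Atom) :
    Transforms4 .blank (Formula.four X Y).graph := by
  refine .curry (.curry ?_)
  refine .trans (.pair ((Transforms4.left _ _).trans ((Transforms4.right _ _).trans
      X.graph_strong.1)) ((Transforms4.right _ _).trans
        ((graph_and _ _).trans (X.graph_strong.juxt (.refl _))).2.broken)) ?_
  -- The added scheme is a single strong deiteration: `*X {*X Y}` becomes `*X {Y}`.
  exact Transforms4.trans (.single (.strongDeiter .hole (.broken .hole) Y.graph X.graph le_rfl))
    (.right _ _)

theorem GT4Axiom.graph {X : Formula Atom} (h : GT4Axiom X) : Transforms4 .blank X.graph := by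
  have hs : ∀ {X : Formula Atom}, GT4Scheme X → Transforms4 .blank X.graph := by
    rintro _ (h | ⟨X, Y⟩)
    · exact h.graph
    · exact Formula.graph_four X Y
  cases h with
  | base h => exact hs h
  | plus h => exact (hs h).necessitation.trans (Formula.graph_strong _).2

theorem Consequence4.graph {X Y : Formula Atom} (h : Consequence4 X Y) :
    Transforms4 X.graph Y.graph := by
  induction h with
  | ax h => exact (Transforms4.blank _).trans h.graph
  | hyp h => cases h; exact .refl _
  | mp _ _ ih ih' => exact .mp ih ih'

theorem ToGraph.transforms4_iff {X Y : Formula Atom} (hX : ToGraph X G) (hY : ToGraph Y H) :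
    Transforms4 G H ↔ Consequence4 X Y := by
  refine ⟨fun h => TransitiveEntails.consequence4 fun S F hF Mo M hM => ?_, fun h => ?_⟩
  · exact (hY.holds_iff Mo M).2 (h.sound hF M ((hX.holds_iff Mo M).1 hM))
  · exact hX.equiv.1.trans (h.graph.trans hY.equiv.2)

theorem ToFormula.transforms4_iff {X Y : Formula Atom} (hX : ToFormula G X)
    (hY : ToFormula H Y) : Transforms4 G H ↔ Consequence4 X Y := by
  refine ⟨fun h => TransitiveEntails.consequence4 fun S F hF Mo M hM => ?_, fun h => ?_⟩
  · exact (hY.holds_iff Mo M).2 (h.sound hF M ((hX.holds_iff Mo M).1 hM))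
  · exact hX.equiv.1.trans (h.graph.trans hY.equiv.2)

end Calculus

end ExGraph

theorem mainTheorem6 {Atom : Type u} :
    -- the added axiom characterizes transitivity of accessibility
    (∀ (S : Type v) (F : ExGraph.Frame S), Nonempty Atom →
      ((∀ (Mo : ExGraph.Model Atom F) (X Y : ExGraph.Formula Atom),
          Mo.IsTrue (ExGraph.Formula.four X Y)) ↔
        ∀ M N P : S, F.rel M N → F.rel N P → F.rel M P)) ∧
    -- a) `G` is a theorem of GET4 iff `G″` is a theorem of GT4
    (∀ (G : ExGraph.Graph Atom) (X : ExGraph.Formula Atom), ExGraph.ToFormula G X →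
      (ExGraph.TGET4 G ↔ ExGraph.TT4 X)) ∧
    -- b) `X` is a theorem of GT4 iff `X′` is a theorem of GET4
    (∀ (X : ExGraph.Formula Atom) (G : ExGraph.Graph Atom), ExGraph.ToGraph X G →
      (ExGraph.TT4 X ↔ ExGraph.TGET4 G)) ∧
    -- c) `G ≫ H` iff `H″` is a consequence of `G″`
    (∀ (G H : ExGraph.Graph Atom) (X Y : ExGraph.Formula Atom),
      ExGraph.ToFormula G X → ExGraph.ToFormula H Y →
      (ExGraph.Transforms4 G H ↔ ExGraph.Consequence4 X Y)) ∧
    -- d) `X′ ≫ Y′` iff `Y` is a consequence of `X`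
    (∀ (X Y : ExGraph.Formula Atom) (G H : ExGraph.Graph Atom),
      ExGraph.ToGraph X G → ExGraph.ToGraph Y H →
      (ExGraph.Transforms4 G H ↔ ExGraph.Consequence4 X Y)) := by
  exact ⟨fun S F _ => ExGraph.four_isTrue_iff_transitive F,
    fun _ _ h => (ExGraph.ToFormula.blank.transforms4_iff h).trans ExGraph.consequence4_lam,
    fun _ _ h => ((ExGraph.ToGraph.lam.transforms4_iff h).trans ExGraph.consequence4_lam).symm,
    fun _ _ _ _ h h' => h.transforms4_iff h',
    fun _ _ _ _ h h' => h.transforms4_iff h'⟩
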